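/- Let $(P_n)_{n\ge1}$ be independent and identically distributed random variables with values in $[0,1]$. Define the break points $(A_{n,k})_{n\ge0,\,0\le k\le n+1}$ of the random stratified fragmentation by $A_{n,0}=0$ and $A_{n,n+1}=1$ for all $n\ge0$ and, for $n\ge1$ and $1\le k\le n$, $$A_{n,k}=P_nA_{n-1,k-1}+(1-P_n)A_{n-1,k},$$ and let $G_n=\frac1n\sum_{k=1}^n\delta_{A_{n,k}}$ be their empirical distribution. Let $\Phi$ be the distribution function of the standard normal law and $Q=\Phi^{-1}:(0,1)\to\mathbb R$ its quantile function. Assume that $\mathbb P(P_1\in(0,1))>0$ and set $s=\mathbb E(P_1(1-P_1))$. Then $Q$ is differentiable on $(0,1)$ and, almost surely, as $n\to\infty$, the Radon measures $\sqrt n\,G_n/\sqrt s$, restricted to $(0,1)$, converge vaguely on $(0,1)$ to the Radon measure with density $Q'$ with respect to Lebesgue measure. That is, almost surely, for every continuous function $f$ with compact support in $(0,1)$, $$\frac{\sqrt n}{\sqrt s}\int_{(0,1)} f\,dG_n\longrightarrow\int_0^1 f(x)\,Q'(x)\,dx .$$ -/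

import Mathlib

open MeasureTheory ProbabilityTheory Filter Topology
open scoped ENNReal CompactlySupported

noncomputable section

/-- Break points `a_{n,k}` (`0 ≤ k ≤ n + 1`) of fragmentation with erasure, for a family of splitting
proportions `p n k` (only `n ≥ 1`, `1 ≤ k ≤ n` is used):
`a_{n,0} = 0`, `a_{n,n+1} = 1` and, for `1 ≤ k ≤ n`,
`a_{n,k} = p_{n,k} a_{n-1,k-1} + (1 - p_{n,k}) a_{n-1,k}`. The value for `k > n + 1` is irrelevant. -/
def breakPoint (p : ℕ → ℕ → ℝ) : ℕ → ℕ → ℝ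
  | _, 0 => 0
  | 0, _ + 1 => 1
  | n + 1, k + 1 =>
      if k + 1 ≤ n + 1 then
        p (n + 1) (k + 1) * breakPoint p n k
          + (1 - p (n + 1) (k + 1)) * breakPoint p n (k + 1)
      else 1

/-- Empirical distribution `(1/n) ∑_{k=1}^n δ_{a_{n,k}}` of the break points. -/
def empiricalMeasure (p : ℕ → ℕ → ℝ) (n : ℕ) : Measure ℝ :=
  (n : ℝ≥0∞)⁻¹ • ∑ k ∈ Finset.Icc 1 n, Measure.dirac (breakPoint p n k)

/-- The splitting proportions of a stratified fragmentation: `p_{n,k} = p_n` for all `k`. -/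
def stratified (p : ℕ → ℝ) : ℕ → ℕ → ℝ := fun n _ => p n

/-- Restriction to the open interval `(0,1)`, as a measure on that space. -/
def restrictOpenUnit (ν : Measure ℝ) : Measure (Set.Ioo (0 : ℝ) 1) :=
  ν.comap Subtype.val

/-- The quantile function `Q = Φ⁻¹` of the standard normal distribution function `Φ`
(meaningful on `(0,1)`, the range of `Φ`). -/
def normalQuantile : ℝ → ℝ :=
  Function.invFun (fun t : ℝ => cdf (gaussianReal 0 1) t)

/-- The measure on `(0,1)` with density `Q'` with respect to Lebesgue measure. -/
def quantileDensityMeasure : Measure (Set.Ioo (0 : ℝ) 1) :=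
  (restrictOpenUnit volume).withDensity
    (fun x => ENNReal.ofReal (deriv normalQuantile (x : ℝ)))

/-- Vague convergence of a sequence of Radon measures to a Radon measure: convergence of the
integrals of all continuous functions with compact support. -/
def VaguelyConverges {X : Type*} [TopologicalSpace X] [MeasurableSpace X] [BorelSpace X]
    (ν : ℕ → Measure X) (ν' : Measure X) : Prop :=
  (∀ n, (ν n).Regular) ∧ ν'.Regular ∧
    ∀ f : C_c(X, ℝ), Tendsto (fun n => ∫ x, f x ∂(ν n)) atTop (𝓝 (∫ x, f x ∂ν'))

end

/-! Fix a realisation `p` of the proportions. Let `F_n` be the distribution function of a sum of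
independent Bernoulli(`p i`) variables, `i ≤ n`. Conditioning on the last summand gives `F_n(x) =
p_n F_{n-1}(x-1) + (1-p_n) F_{n-1}(x)`, which is the recursion of the break points; hence `a_{n,k} =
F_n(k-1)` (`breakPoint_stratified`).

Since `F_n` is constant on each `[j, j+1)`, a sum of `g(a_{n,k})` with `g` vanishing at 0 and 1
equals `∫ g(F_n(x)) dx`. Put `m_n = p_1 + ... + p_n` and substitute `x = m_n + √(ns) t`. The
normalised sum becomes `∫ g(F_n(m_n + √(ns) t)) dt`, which tends to `∫ g(Φ(t)) dt` by the central
limit theorem (`tendsto_poissonBinomialCDF`) and dominated convergence. The change of variables `t =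
Q(x)` turns this limit into `∫ g Q'`.

The central limit theorem only needs the averages of `p_i(1-p_i)` to converge to `s > 0`. This holds
almost surely by the strong law of large numbers, the only place where randomness of the proportions
is used. -/

/-! ### Poisson binomial laws and the break points -/

/-- The law of a sum of `n` independent Bernoulli variables with parameters `p 1, …, p n`. -/
noncomputable def poissonBinomial (p : ℕ → ℝ) : ℕ → Measure ℝ
  | 0 => Measure.dirac 0
  | n + 1 => ENNReal.ofReal (1 - p (n + 1)) • poissonBinomial p n
      + ENNReal.ofReal (p (n + 1)) • (poissonBinomial p n).map (fun x => x + 1)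

lemma isProbabilityMeasure_poissonBinomial {p : ℕ → ℝ}
    (hp : ∀ n, 1 ≤ n → p n ∈ Set.Icc (0 : ℝ) 1) (n : ℕ) :
    IsProbabilityMeasure (poissonBinomial p n) := by
  induction n with
  | zero => rw [poissonBinomial]; infer_instance
  | succ n ih =>
    have := Measure.isProbabilityMeasure_map (μ := poissonBinomial p n)
      (f := fun x : ℝ => x + 1) (by fun_prop)
    have h := hp (n + 1) (by simp)
    constructor
    rw [poissonBinomial, Measure.add_apply, Measure.smul_apply, Measure.smul_apply,
      measure_univ, measure_univ, smul_eq_mul, smul_eq_mul, mul_one, mul_one,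
      ← ENNReal.ofReal_add (by linarith [h.2]) h.1]
    simp

/-- Distribution function of `poissonBinomial`. -/
noncomputable def poissonBinomialCDF (p : ℕ → ℝ) (n : ℕ) (x : ℝ) : ℝ :=
  (poissonBinomial p n).real (Set.Iic x)

lemma poissonBinomialCDF_zero (p : ℕ → ℝ) (x : ℝ) :
    poissonBinomialCDF p 0 x = if 0 ≤ x then 1 else 0 := by
  simp [poissonBinomialCDF, poissonBinomial, measureReal_def, Set.indicator_apply]
  split_ifs <;> simp

lemma poissonBinomialCDF_succ {p : ℕ → ℝ} (hp : ∀ n, 1 ≤ n → p n ∈ Set.Icc (0 : ℝ) 1)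
    (n : ℕ) (x : ℝ) :
    poissonBinomialCDF p (n + 1) x
      = p (n + 1) * poissonBinomialCDF p n (x - 1)
        + (1 - p (n + 1)) * poissonBinomialCDF p n x := by
  have := isProbabilityMeasure_poissonBinomial hp n
  have h := hp (n + 1) (by simp)
  have hpre : (fun y : ℝ => y + 1) ⁻¹' Set.Iic x = Set.Iic (x - 1) := by
    ext y; simp [le_sub_iff_add_le]
  rw [poissonBinomialCDF, poissonBinomial, measureReal_def, Measure.add_apply,
    Measure.smul_apply, Measure.smul_apply, Measure.map_apply (by fun_prop) measurableSet_Iic,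
    hpre, smul_eq_mul, smul_eq_mul,
    ENNReal.toReal_add (by finiteness) (by finiteness)]
  simp only [ENNReal.toReal_mul, ENNReal.toReal_ofReal h.1,
    ENNReal.toReal_ofReal (sub_nonneg.2 h.2), poissonBinomialCDF, measureReal_def]
  ring

lemma monotone_poissonBinomialCDF {p : ℕ → ℝ} (hp : ∀ n, 1 ≤ n → p n ∈ Set.Icc (0 : ℝ) 1)
    (n : ℕ) : Monotone (poissonBinomialCDF p n) := fun x y h => by
  have := isProbabilityMeasure_poissonBinomial hp n
  exact measureReal_mono (Set.Iic_subset_Iic.2 h)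

lemma poissonBinomialCDF_of_neg {p : ℕ → ℝ} (hp : ∀ n, 1 ≤ n → p n ∈ Set.Icc (0 : ℝ) 1)
    (n : ℕ) {x : ℝ} (hx : x < 0) : poissonBinomialCDF p n x = 0 := by
  induction n generalizing x with
  | zero => simp [poissonBinomialCDF_zero, hx]
  | succ n ih => simp [poissonBinomialCDF_succ hp, ih hx, ih (show x - 1 < 0 by linarith)]

lemma poissonBinomialCDF_of_le {p : ℕ → ℝ} (hp : ∀ n, 1 ≤ n → p n ∈ Set.Icc (0 : ℝ) 1)
    (n : ℕ) {x : ℝ} (hx : n ≤ x) : poissonBinomialCDF p n x = 1 := by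
  induction n generalizing x with
  | zero => simp_all [poissonBinomialCDF_zero]
  | succ n ih =>
    push_cast at hx
    simp [poissonBinomialCDF_succ hp, ih (show (n : ℝ) ≤ x by linarith),
      ih (show (n : ℝ) ≤ x - 1 by linarith)]

/-- The law is carried by the integers, so its distribution function jumps only there. -/
lemma poissonBinomialCDF_floor {p : ℕ → ℝ} (hp : ∀ n, 1 ≤ n → p n ∈ Set.Icc (0 : ℝ) 1)
    (n : ℕ) (x : ℝ) : poissonBinomialCDF p n ⌊x⌋ = poissonBinomialCDF p n x := by
  induction n generalizing x with
  | zero =>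
    simp only [poissonBinomialCDF_zero, Int.cast_nonneg_iff, Int.floor_nonneg]
  | succ n ih =>
    rw [poissonBinomialCDF_succ hp, poissonBinomialCDF_succ hp, ih x, ← ih (x - 1)]
    simp

/-- Both sides obey the same recursion. The shift by one makes the boundary values agree: the
distribution function is 0 at `-1` and 1 at `n`. -/
lemma breakPoint_stratified {p : ℕ → ℝ} (hp : ∀ n, 1 ≤ n → p n ∈ Set.Icc (0 : ℝ) 1)
    (n k : ℕ) (hk : k ≤ n + 1) :
    breakPoint (stratified p) n k = poissonBinomialCDF p n (k - 1) := by
  induction n generalizing k with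
  | zero =>
    interval_cases k <;> simp [breakPoint, poissonBinomialCDF_zero]
  | succ n ih =>
    cases k with
    | zero => rw [breakPoint, poissonBinomialCDF_of_neg hp _ (by simp)]
    | succ k =>
      rw [breakPoint]
      split_ifs with h
      · rw [ih k (by omega), ih (k + 1) h, poissonBinomialCDF_succ hp]
        simp [stratified]
      · have : k = n + 1 := by omega
        subst this
        rw [poissonBinomialCDF_of_le hp _ (by simp)]

/-! ### Characteristic functions and the central limit theorem -/

lemma charFun_poissonBinomial {p : ℕ → ℝ} (hp : ∀ n, 1 ≤ n → p n ∈ Set.Icc (0 : ℝ) 1)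
    (n : ℕ) (t : ℝ) :
    charFun (poissonBinomial p n) t
      = ∏ i ∈ Finset.range n, ((1 - p (i + 1)) + p (i + 1) * Complex.exp (t * Complex.I)) := by
  induction n with
  | zero => simp [poissonBinomial]
  | succ n ih =>
    have := isProbabilityMeasure_poissonBinomial hp n
    have h := hp (n + 1) (by simp)
    have hint : ∀ (ν : Measure ℝ) [IsFiniteMeasure ν],
        Integrable (fun x : ℝ => Complex.exp (t * x * Complex.I)) ν := fun ν _ =>
      Integrable.of_bound (C := 1) (by fun_prop) (ae_of_all _ fun x => by
        rw [← Complex.ofReal_mul, Complex.norm_exp_ofReal_mul_I])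
    have hmap : ∫ x : ℝ, Complex.exp (t * x * Complex.I) ∂(poissonBinomial p n).map (fun x => x + 1)
        = charFun (poissonBinomial p n) t * Complex.exp (t * Complex.I) := by
      rw [integral_map (by fun_prop) (by fun_prop), charFun_apply_real, ← integral_mul_const]
      congr 1 with x
      rw [← Complex.exp_add]
      push_cast
      ring_nf
    rw [Finset.prod_range_succ, ← ih, poissonBinomial, charFun_apply_real,
      integral_add_measure ((hint _).smul_measure (by finiteness))
        ((hint _).smul_measure (by finiteness)), integral_smul_measure, integral_smul_measure,
      hmap, ← charFun_apply_real, ENNReal.toReal_ofReal h.1,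
      ENNReal.toReal_ofReal (sub_nonneg.2 h.2), Complex.real_smul, Complex.real_smul]
    push_cast
    ring

/-- Factors are exchanged one at a time; the remaining factors have norm at most 1 and do not
amplify the error. -/
lemma norm_prod_sub_prod_le {ι : Type*} (s : Finset ι) (a b : ι → ℂ)
    (ha : ∀ i ∈ s, ‖a i‖ ≤ 1) (hb : ∀ i ∈ s, ‖b i‖ ≤ 1) :
    ‖∏ i ∈ s, a i - ∏ i ∈ s, b i‖ ≤ ∑ i ∈ s, ‖a i - b i‖ := by
  classical
  induction s using Finset.induction_on with
  | empty => simp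
  | insert j s hj ih =>
    rw [Finset.prod_insert hj, Finset.prod_insert hj, Finset.sum_insert hj]
    have ih' := ih (fun i hi => ha i (by simp [hi])) (fun i hi => hb i (by simp [hi]))
    have h1 : ‖∏ i ∈ s, b i‖ ≤ 1 := by
      rw [norm_prod]
      exact Finset.prod_le_one (fun _ _ => norm_nonneg _) fun i hi => hb i (by simp [hi])
    calc ‖a j * ∏ i ∈ s, a i - b j * ∏ i ∈ s, b i‖
        = ‖(a j - b j) * ∏ i ∈ s, b i + a j * (∏ i ∈ s, a i - ∏ i ∈ s, b i)‖ := by ring_nf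
      _ ≤ ‖a j - b j‖ * ‖∏ i ∈ s, b i‖ + ‖a j‖ * ‖∏ i ∈ s, a i - ∏ i ∈ s, b i‖ := by
        rw [← norm_mul, ← norm_mul]; exact norm_add_le _ _
      _ ≤ ‖a j - b j‖ * 1 + 1 * ∑ i ∈ s, ‖a i - b i‖ := by
        gcongr
        exact ha j (by simp)
      _ = _ := by ring

lemma norm_exp_sub_quadratic_le (c : ℝ) (hc : |c| ≤ 1) :
    ‖Complex.exp (c * Complex.I) - (1 + c * Complex.I - c ^ 2 / 2)‖ ≤ 3 * |c| ^ 3 := by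
  have h := Complex.norm_exp_sub_sum_le_norm_mul_exp (c * Complex.I) 3
  have e : ∑ m ∈ Finset.range 3, ((c : ℂ) * Complex.I) ^ m / (m.factorial : ℂ)
      = 1 + c * Complex.I - c ^ 2 / 2 := by
    simp [Finset.sum_range_succ, mul_pow]; ring
  rw [e] at h
  refine h.trans ?_
  have h1 : ‖(c : ℂ) * Complex.I‖ = |c| := by simp
  rw [h1, mul_comm]
  gcongr
  calc Real.exp |c| ≤ Real.exp 1 := Real.exp_le_exp.2 hc
    _ ≤ 3 := by linarith [Real.exp_one_lt_d9]

/-- Characteristic function of a centred Bernoulli variable against that of a centred Gaussian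
variable with the same variance. -/
lemma norm_centeredBernoulli_sub_exp_le {p θ : ℝ} (hp : p ∈ Set.Icc (0 : ℝ) 1) (hθ : |θ| ≤ 1) :
    ‖((1 - p) + p * Complex.exp (θ * Complex.I)) * Complex.exp (-(p * θ * Complex.I))
      - Complex.exp (-(p * (1 - p) * θ ^ 2 / 2))‖ ≤ 4 * |θ| ^ 3 := by
  obtain ⟨h0, h1⟩ := hp
  have hb1 : |-(p * θ)| ≤ |θ| := by
    rw [abs_neg, abs_mul, abs_of_nonneg h0]
    exact mul_le_of_le_one_left (abs_nonneg _) h1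
  have hb2 : |(1 - p) * θ| ≤ |θ| := by
    rw [abs_mul, abs_of_nonneg (sub_nonneg.2 h1)]
    exact mul_le_of_le_one_left (abs_nonneg _) (by linarith)
  have e1 := norm_exp_sub_quadratic_le _ (hb1.trans hθ)
  have e2 := norm_exp_sub_quadratic_le _ (hb2.trans hθ)
  have hv : ‖(-(p * (1 - p) * θ ^ 2 / 2) : ℂ)‖ ≤ |θ| ^ 2 := by
    have : (-(p * (1 - p) * θ ^ 2 / 2) : ℂ) = ((-(p * (1 - p) * θ ^ 2 / 2) : ℝ) : ℂ) := by
      push_cast; ring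
    rw [this, Complex.norm_real, Real.norm_eq_abs, abs_neg, abs_of_nonneg
      (by have := mul_nonneg h0 (sub_nonneg.2 h1); positivity), sq_abs]
    nlinarith [sq_nonneg θ, mul_nonneg h0 (sub_nonneg.2 h1), sq_nonneg (p - 1/2)]
  have hθ2 : |θ| ^ 2 ≤ 1 := pow_le_one₀ (abs_nonneg _) hθ
  have e3 := Complex.norm_exp_sub_one_sub_id_le (hv.trans hθ2)
  set E1 := Complex.exp (((-(p * θ) : ℝ) : ℂ) * Complex.I) with hE1
  set E2 := Complex.exp ((((1 - p) * θ : ℝ) : ℂ) * Complex.I) with hE2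
  set E3 := Complex.exp (-(p * (1 - p) * θ ^ 2 / 2) : ℂ) with hE3
  have r1 : Complex.exp (-(p * θ * Complex.I)) = E1 := by
    rw [hE1]; congr 1; push_cast; ring
  have r2 : Complex.exp (θ * Complex.I) * E1 = E2 := by
    rw [hE1, hE2, ← Complex.exp_add]; congr 1; push_cast; ring
  rw [r1, add_mul, mul_assoc, r2]
  -- A centred Bernoulli variable takes the values `-p` and `1 - p`, with mean 0 and variance
  -- `p(1-p)`. The linear terms therefore cancel and the quadratic ones match the Gaussian exponent,
  -- leaving only Taylor remainders.
  have key : (1 - p) * E1 + p * E2 - E3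
      = ((1 - p : ℝ) : ℂ) * (E1 - (1 + ((-(p * θ) : ℝ) : ℂ) * Complex.I
          - ((-(p * θ) : ℝ) : ℂ) ^ 2 / 2))
        + (p : ℂ) * (E2 - (1 + (((1 - p) * θ : ℝ) : ℂ) * Complex.I
          - (((1 - p) * θ : ℝ) : ℂ) ^ 2 / 2))
        - (E3 - 1 - -(p * (1 - p) * θ ^ 2 / 2)) := by
    push_cast; ring
  rw [key]
  calc _ ≤ (1 - p) * (3 * |-(p * θ)| ^ 3) + p * (3 * |(1 - p) * θ| ^ 3)
        + ‖(-(p * (1 - p) * θ ^ 2 / 2) : ℂ)‖ ^ 2 := by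
        refine (norm_sub_le _ _).trans (add_le_add ((norm_add_le _ _).trans (add_le_add ?_ ?_)) e3)
        · rw [norm_mul, Complex.norm_real, Real.norm_eq_abs, abs_of_nonneg (sub_nonneg.2 h1)]
          exact mul_le_mul_of_nonneg_left e1 (sub_nonneg.2 h1)
        · rw [norm_mul, Complex.norm_real, Real.norm_eq_abs, abs_of_nonneg h0]
          exact mul_le_mul_of_nonneg_left e2 h0
    _ ≤ (1 - p) * (3 * |θ| ^ 3) + p * (3 * |θ| ^ 3) + (|θ| ^ 2) ^ 2 := by
        have := sub_nonneg.2 h1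
        gcongr
    _ = 3 * |θ| ^ 3 + |θ| ^ 3 * |θ| := by ring
    _ ≤ 3 * |θ| ^ 3 + |θ| ^ 3 * 1 := by gcongr
    _ = 4 * |θ| ^ 3 := by ring

lemma norm_centeredBernoulli_le_one {p θ : ℝ} (hp : p ∈ Set.Icc (0 : ℝ) 1) :
    ‖((1 - p) + p * Complex.exp (θ * Complex.I)) * Complex.exp (-(p * θ * Complex.I))‖ ≤ 1 := by
  have h : Complex.exp (-(p * θ * Complex.I)) = Complex.exp (((-(p * θ) : ℝ) : ℂ) * Complex.I) := by
    congr 1; push_cast; ring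
  rw [norm_mul, h, Complex.norm_exp_ofReal_mul_I, mul_one]
  refine (norm_add_le _ _).trans ?_
  have : (1 - p : ℂ) = ((1 - p : ℝ) : ℂ) := by push_cast; ring
  rw [this, norm_mul, Complex.norm_exp_ofReal_mul_I, Complex.norm_real, Complex.norm_real,
    Real.norm_eq_abs, Real.norm_eq_abs, abs_of_nonneg hp.1, abs_of_nonneg (sub_nonneg.2 hp.2)]
  simp

/-- The standardised law of a Poisson binomial variable. -/
noncomputable def standardizedPoissonBinomial (p : ℕ → ℝ) (s : ℝ) (n : ℕ) : Measure ℝ :=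
  (poissonBinomial p n).map
    (fun x => (x - ∑ i ∈ Finset.range n, p (i + 1)) / √(n * s))

lemma isProbabilityMeasure_standardizedPoissonBinomial {p : ℕ → ℝ}
    (hp : ∀ n, 1 ≤ n → p n ∈ Set.Icc (0 : ℝ) 1) (s : ℝ) (n : ℕ) :
    IsProbabilityMeasure (standardizedPoissonBinomial p s n) := by
  have := isProbabilityMeasure_poissonBinomial hp n
  exact Measure.isProbabilityMeasure_map (by fun_prop)

lemma charFun_standardizedPoissonBinomial {p : ℕ → ℝ}
    (hp : ∀ n, 1 ≤ n → p n ∈ Set.Icc (0 : ℝ) 1) (s : ℝ) (n : ℕ) (t : ℝ) :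
    charFun (standardizedPoissonBinomial p s n) t
      = ∏ i ∈ Finset.range n, ((1 - p (i + 1)) + p (i + 1) *
          Complex.exp ((t / √(n * s) : ℝ) * Complex.I))
          * Complex.exp (-(p (i + 1) * (t / √(n * s) : ℝ) * Complex.I)) := by
  rw [Finset.prod_mul_distrib, ← charFun_poissonBinomial hp, ← Complex.exp_sum,
    standardizedPoissonBinomial, charFun_apply_real, charFun_apply_real,
    integral_map (by fun_prop) (by fun_prop), ← integral_mul_const]
  congr 1 with x
  rw [← Complex.exp_add, Finset.sum_neg_distrib, ← Finset.sum_mul, ← Finset.sum_mul]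
  push_cast
  ring_nf

/-- Each Bernoulli factor is replaced by a Gaussian factor of the same variance. The Gaussian
product converges by `hlim`, and the total replacement error vanishes. -/
lemma tendsto_charFun_standardizedPoissonBinomial {p : ℕ → ℝ}
    (hp : ∀ n, 1 ≤ n → p n ∈ Set.Icc (0 : ℝ) 1) {s : ℝ} (hs : 0 < s)
    (hlim : Tendsto (fun n : ℕ => (∑ i ∈ Finset.range n, p (i + 1) * (1 - p (i + 1))) / n)
      atTop (𝓝 s)) (t : ℝ) :
    Tendsto (fun n => charFun (standardizedPoissonBinomial p s n) t) atTop
      (𝓝 (Complex.exp (-(t ^ 2 / 2 : ℝ)))) := by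
  have hsqrt : Tendsto (fun n : ℕ => √(n * s)) atTop atTop :=
    Real.tendsto_sqrt_atTop.comp (tendsto_natCast_atTop_atTop.atTop_mul_const hs)
  have hθ : Tendsto (fun n : ℕ => |t / √(n * s)|) atTop (𝓝 0) := by
    simpa using (hsqrt.const_div_atTop t).abs
  have hG : Tendsto (fun n : ℕ => ∏ i ∈ Finset.range n,
      Complex.exp (-(p (i + 1) * (1 - p (i + 1)) * (t / √(n * s) : ℝ) ^ 2 / 2))) atTop
      (𝓝 (Complex.exp (-(t ^ 2 / 2 : ℝ)))) := by
    have h1 : Tendsto (fun n : ℕ => -((∑ i ∈ Finset.range n, p (i + 1) * (1 - p (i + 1))) / n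
        * (t ^ 2 / (2 * s)))) atTop (𝓝 (-(t ^ 2 / 2))) := by
      have := (hlim.mul_const (t ^ 2 / (2 * s))).neg
      convert this using 2
      field_simp
    have h2 := (Complex.continuous_exp.tendsto _).comp
      ((Complex.continuous_ofReal.tendsto _).comp h1)
    rw [Complex.ofReal_neg] at h2
    refine h2.congr' ?_
    filter_upwards [eventually_gt_atTop 0] with n hn
    have hn' : (0 : ℝ) < n := by exact_mod_cast hn
    simp only [Function.comp]
    rw [← Complex.exp_sum, Finset.sum_neg_distrib, ← Finset.sum_div, ← Finset.sum_mul]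
    have e : (t / √(n * s)) ^ 2 = t ^ 2 / (n * s) := by
      rw [div_pow, Real.sq_sqrt (by positivity)]
    rw [← Complex.ofReal_pow, e]
    have hs' : (s : ℂ) ≠ 0 := by exact_mod_cast hs.ne'
    have hn'' : (n : ℂ) ≠ 0 := by exact_mod_cast hn.ne'
    congr 1
    push_cast
    field_simp
  rw [← sub_zero (Complex.exp _)]
  have hD : Tendsto (fun n : ℕ => (∏ i ∈ Finset.range n,
      Complex.exp (-(p (i + 1) * (1 - p (i + 1)) * (t / √(n * s) : ℝ) ^ 2 / 2)))
        - charFun (standardizedPoissonBinomial p s n) t) atTop (𝓝 0) := by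
    -- With `θ = t / √(ns)`, the `n` errors `4|θ|^3` add up to this bound because `n θ^2 = t^2 / s`.
    have hbd : Tendsto (fun n : ℕ => 4 * (t ^ 2 / s) * |t / √(n * s)|) atTop (𝓝 0) := by
      simpa using hθ.const_mul (4 * (t ^ 2 / s))
    refine squeeze_zero_norm' ?_ hbd
    filter_upwards [eventually_gt_atTop 0, hθ.eventually_le_const zero_lt_one] with n hn hle
    have hn' : (0 : ℝ) < n := by exact_mod_cast hn
    rw [charFun_standardizedPoissonBinomial hp, norm_sub_rev]
    refine (norm_prod_sub_prod_le _ _ _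
      (fun i _ => norm_centeredBernoulli_le_one (hp _ (by simp))) fun i _ => ?_).trans ?_
    · have h := hp (i + 1) (by simp)
      have : (-(p (i + 1) * (1 - p (i + 1)) * (t / √(n * s) : ℝ) ^ 2 / 2) : ℂ)
          = ((-(p (i + 1) * (1 - p (i + 1)) * (t / √(n * s) : ℝ) ^ 2 / 2) : ℝ) : ℂ) := by
        push_cast; ring
      rw [this, ← Complex.ofReal_exp, Complex.norm_real, Real.norm_eq_abs, Real.abs_exp,
        Real.exp_le_one_iff, neg_nonpos]
      have := mul_nonneg h.1 (sub_nonneg.2 h.2)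
      positivity
    · refine (Finset.sum_le_card_nsmul _ _ _
        fun i _ => norm_centeredBernoulli_sub_exp_le (hp (i + 1) (by simp)) hle).trans_eq ?_
      have e : |t / √(n * s)| ^ 2 = t ^ 2 / (n * s) := by
        rw [sq_abs, div_pow, Real.sq_sqrt (by positivity)]
      rw [pow_succ, e, Finset.card_range, nsmul_eq_mul]
      field_simp
  simpa using hG.sub hD

/-- Central limit theorem for sums of independent Bernoulli variables. -/
theorem tendsto_poissonBinomialCDF {p : ℕ → ℝ}
    (hp : ∀ n, 1 ≤ n → p n ∈ Set.Icc (0 : ℝ) 1) {s : ℝ} (hs : 0 < s)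
    (hlim : Tendsto (fun n : ℕ => (∑ i ∈ Finset.range n, p (i + 1) * (1 - p (i + 1))) / n)
      atTop (𝓝 s)) (t : ℝ) :
    Tendsto (fun n : ℕ => poissonBinomialCDF p n
        ((∑ i ∈ Finset.range n, p (i + 1)) + √(n * s) * t)) atTop
      (𝓝 (cdf (gaussianReal 0 1) t)) := by
  let ν : ℕ → ProbabilityMeasure ℝ := fun n => ⟨standardizedPoissonBinomial p s n,
    isProbabilityMeasure_standardizedPoissonBinomial hp s n⟩
  let γ : ProbabilityMeasure ℝ := ⟨gaussianReal 0 1, inferInstance⟩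
  have hν : Tendsto ν atTop (𝓝 γ) := by
    refine ProbabilityMeasure.tendsto_iff_tendsto_charFun.2 fun u => ?_
    have := tendsto_charFun_standardizedPoissonBinomial hp hs hlim u
    simp only [ν, γ, ProbabilityMeasure.coe_mk, charFun_gaussianReal]
    convert this using 3
    push_cast
    simp
  have hnull : (γ : Measure ℝ) (frontier (Set.Iic t)) = 0 := by
    have : NullSingletonClass (gaussianReal 0 1) := nullSingletonClass_gaussianReal one_ne_zero
    simp only [γ, ProbabilityMeasure.coe_mk, frontier_Iic]
    exact measure_singleton t
  have h := ProbabilityMeasure.tendsto_measure_of_null_frontier_of_tendsto' hν hnull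
  rw [cdf_eq_real, measureReal_def]
  refine ((ENNReal.tendsto_toReal (by finiteness)).comp h).congr' ?_
  filter_upwards [eventually_gt_atTop 0] with n hn
  have hpos : 0 < √(n * s) := Real.sqrt_pos.2 (by positivity)
  simp only [Function.comp, ν, ProbabilityMeasure.coe_mk, standardizedPoissonBinomial,
    poissonBinomialCDF, measureReal_def]
  rw [Measure.map_apply (by fun_prop) measurableSet_Iic]
  congr 2
  ext x
  simp only [Set.mem_preimage, Set.mem_Iic, div_le_iff₀ hpos]
  constructor <;> intro h <;> linarith

/-! ### From sums over break points to integrals -/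

lemma measurable_poissonBinomialCDF {p : ℕ → ℝ} (hp : ∀ n, 1 ≤ n → p n ∈ Set.Icc (0 : ℝ) 1)
    (n : ℕ) : Measurable (poissonBinomialCDF p n) :=
  (monotone_poissonBinomialCDF hp n).measurable

lemma sum_comp_poissonBinomialCDF_eq_integral {p : ℕ → ℝ}
    (hp : ∀ n, 1 ≤ n → p n ∈ Set.Icc (0 : ℝ) 1) {g : ℝ → ℝ} (hg : Measurable g)
    {C : ℝ} (hC : ∀ x, |g x| ≤ C) (h0 : g 0 = 0) (h1 : g 1 = 0) (n : ℕ) :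
    ∑ j ∈ Finset.range n, g (poissonBinomialCDF p n j)
      = ∫ x, g (poissonBinomialCDF p n x) := by
  have hm : Measurable fun x => g (poissonBinomialCDF p n x) :=
    hg.comp (measurable_poissonBinomialCDF hp n)
  have hint : ∀ a b : ℝ, IntervalIntegrable (fun x => g (poissonBinomialCDF p n x)) volume a b :=
    fun a b => (intervalIntegrable_const (c := C)).mono_fun hm.aestronglyMeasurable
      (ae_of_all _ fun x => (hC _).trans (le_abs_self C))
  rw [← setIntegral_eq_integral_of_forall_compl_eq_zero (s := Set.Ico (0 : ℝ) n),
    integral_Ico_eq_integral_Ioc, ← intervalIntegral.integral_of_le (by positivity)]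
  · have := intervalIntegral.sum_integral_adjacent_intervals (a := fun k : ℕ => (k : ℝ)) (n := n)
      (fun k _ => hint k (k + 1 : ℕ))
    rw [Nat.cast_zero] at this
    rw [← this]
    refine Finset.sum_congr rfl fun j _ => ?_
    have hj : (j : ℝ) ≤ (j + 1 : ℕ) := by simp
    rw [intervalIntegral.integral_of_le hj, ← integral_Ico_eq_integral_Ioc,
      setIntegral_congr_fun (g := fun _ => g (poissonBinomialCDF p n j)) measurableSet_Ico]
    · simp
    · intro x hx
      have : ⌊x⌋ = j := Int.floor_eq_iff.2 ⟨by simpa using hx.1, by simpa using hx.2⟩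
      simp only
      rw [← poissonBinomialCDF_floor hp, this, Int.cast_natCast]
  · intro x hx
    rcases lt_or_ge x 0 with h | h
    · rw [poissonBinomialCDF_of_neg hp n h, h0]
    · rw [poissonBinomialCDF_of_le hp n (not_lt.1 fun h' => hx ⟨h, h'⟩), h1]

theorem tendsto_sum_comp_poissonBinomialCDF {p : ℕ → ℝ}
    (hp : ∀ n, 1 ≤ n → p n ∈ Set.Icc (0 : ℝ) 1) {s : ℝ} (hs : 0 < s)
    (hlim : Tendsto (fun n : ℕ => (∑ i ∈ Finset.range n, p (i + 1) * (1 - p (i + 1))) / n)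
      atTop (𝓝 s))
    (hΦ : ∀ t, cdf (gaussianReal 0 1) t ∈ Set.Ioo (0 : ℝ) 1)
    {g : ℝ → ℝ} (hg : Measurable g) (hgc : ContinuousOn g (Set.Ioo 0 1))
    {C : ℝ} (hC : ∀ x, |g x| ≤ C) {ε : ℝ} (hε : 0 < ε)
    (hg0 : ∀ x ≤ ε, g x = 0) (hg1 : ∀ x, 1 - ε ≤ x → g x = 0) :
    Tendsto (fun n : ℕ => (√(n * s))⁻¹ * ∑ j ∈ Finset.range n, g (poissonBinomialCDF p n j))
      atTop (𝓝 (∫ t, g (cdf (gaussianReal 0 1) t))) := by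
  set Φ : ℝ → ℝ := fun t => cdf (gaussianReal 0 1) t with hΦdef
  -- By monotonicity, for large `n` the rescaled distribution function is below `ε` left of `U` and
  -- above `1 - ε` right of `T`. There `g` vanishes, so `C` on `[U, T]` dominates.
  obtain ⟨T, hT⟩ : ∃ T, 1 - ε < Φ T :=
    ((tendsto_cdf_atTop (gaussianReal 0 1)).eventually_const_lt (by linarith)).exists
  obtain ⟨U, hU⟩ : ∃ U, Φ U < ε :=
    ((tendsto_cdf_atBot (gaussianReal 0 1)).eventually_lt_const hε).exists
  have hclt := tendsto_poissonBinomialCDF hp hs hlim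
  have hmain : Tendsto (fun n : ℕ => ∫ t, g (poissonBinomialCDF p n
      ((∑ i ∈ Finset.range n, p (i + 1)) + √(n * s) * t))) atTop (𝓝 (∫ t, g (Φ t))) := by
    refine tendsto_integral_filter_of_dominated_convergence
      ((Set.Icc U T).indicator fun _ => C) ?_ ?_ ?_ ?_
    · refine Eventually.of_forall fun n => Measurable.aestronglyMeasurable ?_
      exact hg.comp ((measurable_poissonBinomialCDF hp n).comp (by fun_prop))
    · filter_upwards [(hclt T).eventually_const_lt hT, (hclt U).eventually_lt_const hU]
        with n hnT hnU
      refine ae_of_all _ fun t => ?_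
      by_cases ht : t ∈ Set.Icc U T
      · rw [Set.indicator_of_mem ht]; exact hC _
      · rw [Set.indicator_of_notMem ht, norm_le_zero_iff]
        rcases lt_or_ge t U with h | h
        · refine hg0 _ (le_trans (monotone_poissonBinomialCDF hp n ?_) hnU.le)
          gcongr
        · have h' : T ≤ t := (not_le.1 fun h' => ht ⟨h, h'⟩).le
          refine hg1 _ (hnT.le.trans (monotone_poissonBinomialCDF hp n ?_))
          gcongr
    · rw [integrable_indicator_iff measurableSet_Icc]
      exact integrableOn_const (by simp)
    · refine ae_of_all _ fun t => ?_
      -- Continuity of `g` on the open interval suffices, as the limit `Φ t` never equals 0 or 1.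
      exact ((hgc.continuousAt (isOpen_Ioo.mem_nhds (hΦ t))).tendsto.comp (hclt t))
  refine hmain.congr fun n => ?_
  rw [sum_comp_poissonBinomialCDF_eq_integral hp hg hC (hg0 0 hε.le) (hg1 1 (by linarith))]
  have h1 := Measure.integral_comp_mul_left (fun x => g (poissonBinomialCDF p n
      ((∑ i ∈ Finset.range n, p (i + 1)) + x))) √(n * s)
  rw [h1, integral_add_left_eq_self (fun x => g (poissonBinomialCDF p n x)), smul_eq_mul,
    abs_of_nonneg (by positivity)]

/-! ### The normal distribution function and its quantile function -/

lemma hasStrictDerivAt_cdf_gaussianReal (t : ℝ) :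
    HasStrictDerivAt (fun t : ℝ => cdf (gaussianReal 0 1) t) (gaussianPDFReal 0 1 t) t := by
  have hcont : Continuous (gaussianPDFReal 0 1) := by unfold gaussianPDFReal; fun_prop
  have hint := integrable_gaussianPDFReal 0 1
  have hI : ∀ x : ℝ, cdf (gaussianReal 0 1) x = ∫ y in Set.Iic x, gaussianPDFReal 0 1 y := by
    intro x
    rw [cdf_eq_real, measureReal_def, gaussianReal_apply_eq_integral _ one_ne_zero,
      ENNReal.toReal_ofReal (integral_nonneg fun y => gaussianPDFReal_nonneg _ _ _)]
  have h : (fun x : ℝ => cdf (gaussianReal 0 1) x)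
      = fun x => cdf (gaussianReal 0 1) 0 + ∫ y in (0 : ℝ)..x, gaussianPDFReal 0 1 y := by
    ext x
    rw [← intervalIntegral.integral_Iic_sub_Iic hint.integrableOn hint.integrableOn, hI, hI]
    ring
  rw [h]
  exact (intervalIntegral.integral_hasStrictDerivAt_right hint.intervalIntegrable
    (hcont.stronglyMeasurableAtFilter _ _) hcont.continuousAt).const_add _

lemma continuous_cdf_gaussianReal : Continuous (fun t : ℝ => cdf (gaussianReal 0 1) t) :=
  continuous_iff_continuousAt.2 fun t => (hasStrictDerivAt_cdf_gaussianReal t).hasDerivAt.continuousAt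

lemma strictMono_cdf_gaussianReal : StrictMono (fun t : ℝ => cdf (gaussianReal 0 1) t) := by
  refine strictMono_of_deriv_pos fun t => ?_
  rw [(hasStrictDerivAt_cdf_gaussianReal t).hasDerivAt.deriv]
  exact gaussianPDFReal_pos _ _ _ one_ne_zero

lemma cdf_gaussianReal_mem_Ioo (t : ℝ) : cdf (gaussianReal 0 1) t ∈ Set.Ioo (0 : ℝ) 1 :=
  ⟨(cdf_nonneg _ (t - 1)).trans_lt (strictMono_cdf_gaussianReal (by linarith)),
    (strictMono_cdf_gaussianReal (by linarith : t < t + 1)).trans_le (cdf_le_one _ _)⟩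

lemma normalQuantile_cdf (t : ℝ) : normalQuantile (cdf (gaussianReal 0 1) t) = t :=
  Function.leftInverse_invFun strictMono_cdf_gaussianReal.injective t

lemma cdf_normalQuantile {x : ℝ} (hx : x ∈ Set.Ioo (0 : ℝ) 1) :
    cdf (gaussianReal 0 1) (normalQuantile x) = x := by
  obtain ⟨a, ha⟩ :=
    ((tendsto_cdf_atBot (gaussianReal 0 1)).eventually_lt_const hx.1).exists
  obtain ⟨b, hb⟩ :=
    ((tendsto_cdf_atTop (gaussianReal 0 1)).eventually_const_lt hx.2).exists
  have : x ∈ Set.range (fun t : ℝ => cdf (gaussianReal 0 1) t) :=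
    mem_range_of_exists_le_of_exists_ge continuous_cdf_gaussianReal ⟨a, ha.le⟩ ⟨b, hb.le⟩
  exact Function.invFun_eq this

/-- This is the inverse function theorem: strict differentiability of `Φ` with nonzero derivative
makes a left inverse differentiable, with no prior continuity of `Q`. -/
lemma hasDerivAt_normalQuantile {x : ℝ} (hx : x ∈ Set.Ioo (0 : ℝ) 1) :
    HasDerivAt normalQuantile (gaussianPDFReal 0 1 (normalQuantile x))⁻¹ x := by
  have h := (hasStrictDerivAt_cdf_gaussianReal (normalQuantile x)).to_local_left_inverse
    (gaussianPDFReal_pos _ _ _ one_ne_zero).ne' (Eventually.of_forall normalQuantile_cdf)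
  rw [cdf_normalQuantile hx] at h
  exact h.hasDerivAt

lemma deriv_normalQuantile {x : ℝ} (hx : x ∈ Set.Ioo (0 : ℝ) 1) :
    deriv normalQuantile x = (gaussianPDFReal 0 1 (normalQuantile x))⁻¹ :=
  (hasDerivAt_normalQuantile hx).deriv

lemma deriv_normalQuantile_nonneg {x : ℝ} (hx : x ∈ Set.Ioo (0 : ℝ) 1) :
    0 ≤ deriv normalQuantile x := by
  rw [deriv_normalQuantile hx]
  exact inv_nonneg.2 (gaussianPDFReal_nonneg _ _ _)

lemma continuousOn_deriv_normalQuantile :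
    ContinuousOn (deriv normalQuantile) (Set.Ioo (0 : ℝ) 1) := by
  have hcont : Continuous (gaussianPDFReal 0 1) := by unfold gaussianPDFReal; fun_prop
  refine ContinuousOn.congr (f := fun x => (gaussianPDFReal 0 1 (normalQuantile x))⁻¹) ?_
    fun x hx => deriv_normalQuantile hx
  exact (hcont.comp_continuousOn fun x hx =>
    (hasDerivAt_normalQuantile hx).continuousAt.continuousWithinAt).inv₀
    fun x _ => (gaussianPDFReal_pos _ _ _ one_ne_zero).ne'

/-- Change of variables `t = Q(x)`, where `Q` maps `(0,1)` bijectively onto the line. It requires no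
regularity of `g`. -/
lemma integral_comp_cdf_gaussianReal (g : ℝ → ℝ) :
    ∫ t, g (cdf (gaussianReal 0 1) t)
      = ∫ x in Set.Ioo (0 : ℝ) 1, deriv normalQuantile x * g x := by
  have himage : normalQuantile '' Set.Ioo 0 1 = Set.univ :=
    Set.eq_univ_of_forall fun t => ⟨_, cdf_gaussianReal_mem_Ioo t, normalQuantile_cdf t⟩
  have hinj : Set.InjOn normalQuantile (Set.Ioo 0 1) := fun x hx y hy h => by
    rw [← cdf_normalQuantile hx, ← cdf_normalQuantile hy, h]
  have h := integral_image_eq_integral_abs_deriv_smul measurableSet_Ioo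
    (fun x hx => (hasDerivAt_normalQuantile hx).differentiableAt.hasDerivAt.hasDerivWithinAt) hinj
    (fun t => g (cdf (gaussianReal 0 1) t))
  rw [himage, Measure.restrict_univ] at h
  rw [h]
  refine setIntegral_congr_fun measurableSet_Ioo fun x hx => ?_
  simp only [abs_of_nonneg (deriv_normalQuantile_nonneg hx), cdf_normalQuantile hx, smul_eq_mul]

/-! ### Measures and test functions on the open interval -/

lemma continuous_deriv_normalQuantile_subtype :
    Continuous fun x : Set.Ioo (0 : ℝ) 1 => deriv normalQuantile (x : ℝ) :=
  continuousOn_iff_continuous_domRestrict.1 continuousOn_deriv_normalQuantile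

lemma isFiniteMeasure_restrictOpenUnit (ν : Measure ℝ) (h : ν (Set.Ioo 0 1) ≠ ∞) :
    IsFiniteMeasure (restrictOpenUnit ν) := by
  refine ⟨?_⟩
  rw [restrictOpenUnit, (MeasurableEmbedding.subtype_coe measurableSet_Ioo).comap_apply]
  exact (measure_mono (t := Set.Ioo (0 : ℝ) 1) (by rintro _ ⟨x, -, rfl⟩; exact x.2)).trans_lt h.lt_top

/-- The total mass is infinite, so regularity rests on local finiteness, which follows from
continuity of `Q'`. -/
lemma regular_quantileDensityMeasure : quantileDensityMeasure.Regular := by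
  have := (isOpen_Ioo (a := (0 : ℝ)) (b := 1)).locallyCompactSpace
  have := isFiniteMeasure_restrictOpenUnit volume (by simp)
  have : IsLocallyFiniteMeasure quantileDensityMeasure :=
    IsLocallyFiniteMeasure.withDensity_ofReal continuous_deriv_normalQuantile_subtype
  infer_instance

lemma integral_quantileDensityMeasure (f : Set.Ioo (0 : ℝ) 1 → ℝ) (g : ℝ → ℝ)
    (hfg : ∀ x, f x = g x) :
    ∫ x, f x ∂quantileDensityMeasure = ∫ t, g (cdf (gaussianReal 0 1) t) := by
  have hmeas : Measurable fun x : Set.Ioo (0 : ℝ) 1 =>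
      ENNReal.ofReal (deriv normalQuantile (x : ℝ)) :=
    continuous_deriv_normalQuantile_subtype.measurable.ennreal_ofReal
  rw [integral_comp_cdf_gaussianReal, quantileDensityMeasure,
    integral_withDensity_eq_integral_toReal_smul hmeas (ae_of_all _ fun x => by simp),
    ← integral_subtype_comap measurableSet_Ioo]
  refine integral_congr_ae (ae_of_all _ fun x => ?_)
  simp only [smul_eq_mul, hfg, ENNReal.toReal_ofReal (deriv_normalQuantile_nonneg x.2)]

lemma isFiniteMeasure_empiricalMeasure (p : ℕ → ℕ → ℝ) (n : ℕ) :
    IsFiniteMeasure (empiricalMeasure p n) := by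
  rcases Nat.eq_zero_or_pos n with rfl | hn
  · simp only [empiricalMeasure, Finset.Icc_eq_empty_of_lt zero_lt_one, Finset.sum_empty, smul_zero]
    infer_instance
  · exact Measure.smul_finite _ (by simp [hn.ne'])

lemma integral_empiricalMeasure (p : ℕ → ℕ → ℝ) (n : ℕ) (g : ℝ → ℝ) :
    ∫ x, g x ∂empiricalMeasure p n = (n : ℝ)⁻¹ * ∑ k ∈ Finset.Icc 1 n, g (breakPoint p n k) := by
  rw [empiricalMeasure, integral_smul_measure, integral_finsetSum_measure
    fun k _ => integrable_dirac (by simp)]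
  simp

lemma regular_smul_restrictOpenUnit (ν : Measure ℝ) [IsFiniteMeasure ν] (c : ℝ) :
    (ENNReal.ofReal c • restrictOpenUnit ν).Regular := by
  have := (isOpen_Ioo (a := (0 : ℝ)) (b := 1)).locallyCompactSpace
  have := isFiniteMeasure_restrictOpenUnit ν (by finiteness)
  have : IsFiniteMeasure (ENNReal.ofReal c • restrictOpenUnit ν) :=
    Measure.smul_finite _ (by finiteness)
  infer_instance

lemma integral_restrictOpenUnit (ν : Measure ℝ) (f : Set.Ioo (0 : ℝ) 1 → ℝ) (g : ℝ → ℝ)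
    (hfg : ∀ x, f x = g x) (hg : ∀ x ∉ Set.Ioo (0 : ℝ) 1, g x = 0) :
    ∫ x, f x ∂restrictOpenUnit ν = ∫ x, g x ∂ν := by
  rw [← setIntegral_eq_integral_of_forall_compl_eq_zero hg, restrictOpenUnit,
    ← integral_subtype_comap measurableSet_Ioo]
  simp only [hfg]

/-- Extension by zero. A compact subset of `(0,1)` keeps a positive distance from both endpoints,
which yields `ε`. -/
lemma exists_extension_of_compactlySupported (f : C_c(Set.Ioo (0 : ℝ) 1, ℝ)) :
    ∃ g : ℝ → ℝ, Measurable g ∧ ContinuousOn g (Set.Ioo 0 1) ∧ (∀ x, f x = g x) ∧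
      (∃ C, ∀ x, |g x| ≤ C) ∧
      ∃ ε > 0, (∀ x ≤ ε, g x = 0) ∧ ∀ x, 1 - ε ≤ x → g x = 0 := by
  have hval : ∀ x, Function.extend Subtype.val f (0 : ℝ → ℝ) x.1 = f x :=
    fun x => Subtype.val_injective.extend_apply _ _ _
  have hout : ∀ x ∉ Subtype.val '' tsupport f,
      Function.extend Subtype.val f (0 : ℝ → ℝ) x = 0 := by
    intro x hx
    by_cases h : x ∈ Set.Ioo (0 : ℝ) 1
    · rw [hval ⟨x, h⟩]
      exact image_eq_zero_of_notMem_tsupport fun h' => hx ⟨_, h', rfl⟩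
    · exact Function.extend_apply' _ _ _ fun ⟨y, hy⟩ => h (hy ▸ y.2)
  refine ⟨Function.extend Subtype.val f 0, ?_, ?_, fun x => (hval x).symm, ?_, ?_⟩
  · exact (MeasurableEmbedding.subtype_coe measurableSet_Ioo).measurable_extend
      f.continuous.measurable measurable_zero
  · rw [continuousOn_iff_continuous_domRestrict]
    exact f.continuous.congr fun x => (hval x).symm
  · obtain ⟨C, hC⟩ := f.hasCompactSupport.exists_bound_of_continuous f.continuous
    refine ⟨max C 0, fun x => ?_⟩
    by_cases h : x ∈ Set.Ioo (0 : ℝ) 1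
    · rw [hval ⟨x, h⟩]; exact (hC _).trans (le_max_left _ _)
    · rw [hout x fun ⟨y, _, hy⟩ => h (hy ▸ y.2)]; simp
  · have hK : IsCompact (Subtype.val '' tsupport f) :=
      f.hasCompactSupport.isCompact.image continuous_subtype_val
    obtain ⟨ε, hε, h⟩ := hK.exists_forall_le' (f := fun x : ℝ => min x (1 - x)) (a := 0)
      (by fun_prop) (by rintro _ ⟨x, -, rfl⟩; exact lt_min x.2.1 (sub_pos.2 x.2.2))
    -- Halving makes the inequality strict: points of the support satisfy `ε ≤ x` and `ε ≤ 1 - x`.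
    refine ⟨ε / 2, half_pos hε, fun x hx => hout x fun hx' => ?_, fun x hx => hout x fun hx' => ?_⟩
    · linarith [(le_min_iff.1 (h x hx')).1]
    · linarith [(le_min_iff.1 (h x hx')).2]

/-! ### Vague convergence, for fixed and then for random proportions -/

/-- Vague convergence for a fixed sequence of splitting proportions, whose variances have a positive
Cesàro limit. -/
theorem vaguelyConverges_stratified {p : ℕ → ℝ}
    (hp : ∀ n, 1 ≤ n → p n ∈ Set.Icc (0 : ℝ) 1) {s : ℝ} (hs : 0 < s)
    (hlim : Tendsto (fun n : ℕ => (∑ i ∈ Finset.range n, p (i + 1) * (1 - p (i + 1))) / n)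
      atTop (𝓝 s)) :
    VaguelyConverges
      (fun n : ℕ => ENNReal.ofReal (√(n : ℝ) / √s) •
        restrictOpenUnit (empiricalMeasure (stratified p) n))
      quantileDensityMeasure := by
  refine ⟨fun n => ?_, regular_quantileDensityMeasure, fun f => ?_⟩
  · have := isFiniteMeasure_empiricalMeasure (stratified p) n
    exact regular_smul_restrictOpenUnit _ _
  obtain ⟨g, hgm, hgc, hfg, ⟨C, hC⟩, ε, hε, hg0, hg1⟩ := exists_extension_of_compactlySupported f
  rw [integral_quantileDensityMeasure f g hfg]
  refine (tendsto_sum_comp_poissonBinomialCDF hp hs hlim cdf_gaussianReal_mem_Ioo hgm hgc hC hε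
    hg0 hg1).congr fun n => ?_
  have hout : ∀ x ∉ Set.Ioo (0 : ℝ) 1, g x = 0 := fun x hx => by
    rcases le_or_gt x ε with h | h
    · exact hg0 x h
    · refine hg1 x (le_trans (by linarith) (not_lt.1 fun h' => hx ⟨hε.trans h, h'⟩))
  have hsum : ∑ k ∈ Finset.Icc 1 n, g (breakPoint (stratified p) n k)
      = ∑ j ∈ Finset.range n, g (poissonBinomialCDF p n j) := by
    refine (Finset.sum_nbij' (fun j => j + 1) (fun k => k - 1) ?_ ?_ ?_ ?_ ?_).symm
    · intro j hj; simp at hj ⊢; omega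
    · intro k hk; simp at hk ⊢; omega
    · intro j hj; simp
    · intro k hk; simp at hk ⊢; omega
    · intro j hj
      rw [breakPoint_stratified hp n _ (by simp at hj; omega)]
      simp
  rw [integral_smul_measure, integral_restrictOpenUnit _ f g hfg hout, integral_empiricalMeasure,
    hsum, ENNReal.toReal_ofReal (by positivity), smul_eq_mul, ← mul_assoc]
  -- What remains is `(√n / √s) / n = 1 / √(ns)`; at `n = 0` both sides are 0.
  congr 1
  rcases Nat.eq_zero_or_pos n with rfl | hn
  · simp
  · have hn' : (0 : ℝ) < n := by exact_mod_cast hn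
    have h1 : √(n : ℝ) ≠ 0 := (Real.sqrt_pos.2 hn').ne'
    have h2 : √s ≠ 0 := (Real.sqrt_pos.2 hs).ne'
    rw [Real.sqrt_mul hn'.le]
    field_simp
    rw [Real.sq_sqrt hn'.le]

theorem mainTheorem4 {Ω : Type*} [MeasurableSpace Ω] (μ : Measure Ω) [IsProbabilityMeasure μ]
    (P : ℕ → Ω → ℝ)
    (hmeas : ∀ n, 1 ≤ n → Measurable (P n))
    (hrange : ∀ n, 1 ≤ n → ∀ ω, P n ω ∈ Set.Icc (0 : ℝ) 1)
    (hindep : iIndepFun (fun n : ℕ => P (n + 1)) μ)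
    (hident : ∀ n, 1 ≤ n → IdentDistrib (P n) (P 1) μ μ)
    (hpos : 0 < μ {ω | P 1 ω ∈ Set.Ioo (0 : ℝ) 1})
    (s : ℝ) (hs : s = ∫ ω, P 1 ω * (1 - P 1 ω) ∂μ) :
    DifferentiableOn ℝ normalQuantile (Set.Ioo 0 1) ∧
    ∀ᵐ ω ∂μ, VaguelyConverges
      (fun n : ℕ => ENNReal.ofReal (√(n : ℝ) / √s) •
        restrictOpenUnit (empiricalMeasure (stratified fun m => P m ω) n))
      quantileDensityMeasure := by
  refine ⟨fun x hx => (hasDerivAt_normalQuantile hx).differentiableAt.differentiableWithinAt, ?_⟩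
  have hP := hrange 1 le_rfl
  have hnonneg : ∀ ω, 0 ≤ P 1 ω * (1 - P 1 ω) := fun ω =>
    mul_nonneg (hP ω).1 (sub_nonneg.2 (hP ω).2)
  have hint : Integrable (fun ω => P 1 ω * (1 - P 1 ω)) μ := by
    have := hmeas 1 le_rfl
    refine Integrable.of_bound (C := 1) (by fun_prop) (ae_of_all _ fun ω => ?_)
    rw [Real.norm_eq_abs, abs_of_nonneg (hnonneg ω)]
    nlinarith [(hP ω).1, (hP ω).2]
  have hs0 : 0 < s := by
    rw [hs, integral_pos_iff_support_of_nonneg hnonneg hint]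
    refine hpos.trans_le (measure_mono fun ω hω => ?_)
    exact (mul_pos hω.1 (sub_pos.2 hω.2)).ne'
  have hu : Measurable fun x : ℝ => x * (1 - x) := by fun_prop
  -- The exceptional null set comes from this single limit and so does not depend on the test
  -- function.
  have hslln := strong_law_ae_real (μ := μ) (fun n ω => P (n + 1) ω * (1 - P (n + 1) ω)) hint
    (fun i j hij => (hindep.indepFun hij).comp hu hu)
    (fun i => (hident (i + 1) (by simp)).comp hu)
  filter_upwards [hslln] with ω hω
  refine vaguelyConverges_stratified (fun n hn => hrange n hn ω) hs0 ?_
  simpa [hs] using hω
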